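/- Let $\Gamma$ be a finitely generated amenable group (i.e. $\Gamma$ satisfies the Følner condition: for every finite $K\subset\Gamma$ and $\varepsilon>0$ there is a finite non-empty $F\subset\Gamma$ with $|gF\,\triangle\,F|\le\varepsilon|F|$ for all $g\in K$), let $\Sigma$ be a finite symmetric generating set of $\Gamma$, and let $\Gamma\supset N_1\supset N_2\supset\dots$ be a nested sequence of finite-index normal subgroups of $\Gamma$ with $\bigcap_{k=1}^\infty N_k=\{1\}$. For a graph $G$ of bounded vertex degrees let $\operatorname{spec}(G)$ be the spectrum of its graph Laplacian $\Delta_G$ on $\ell^2(V(G))$, $(\Delta_G f)(x)=\sum_{y\sim x}(f(x)-f(y))$; it is a non-empty compact set. For a group $H$ and a finite symmetric set $S\subset H$ let $\operatorname{Cay}(H,S)$ be the simple graph with vertex set $H$ in which $x\ne y$ are adjacent if $y=xs$ for some $s\in S$, and let $\operatorname{Cay}(\Gamma/N_k,\Sigma)$ be taken with respect to the image of $\Sigma$ in $\Gamma/N_k$. Then $\operatorname{spec}(\operatorname{Cay}(\Gamma/N_k,\Sigma))$ converges to $\operatorname{spec}(\operatorname{Cay}(\Gamma,\Sigma))$ in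 the Hausdorff topology as $k\to\infty$. -/

import Mathlib

open Filter Topology TopologicalSpace
open scoped Pointwise symmDiff

/-- A discrete group is amenable if it satisfies the Følner condition: for every finite set `K` of
group elements and every `ε > 0` there is a non-empty finite set `F` which every element of `K`
translates to a set that differs from `F` in at most `ε * |F|` points. -/
def IsAmenableGroup (Γ : Type*) [Group Γ] : Prop :=
  ∀ (K : Finset Γ) (ε : ℝ), 0 < ε → ∃ F : Finset Γ, F.Nonempty ∧
    ∀ g ∈ K, (((g • (F : Set Γ)) ∆ (F : Set Γ)).ncard : ℝ) ≤ ε * (F.card : ℝ)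

namespace SimpleGraph

variable {V : Type*}

/-- There is a finite uniform bound on the vertex degrees of the graph `G`. -/
def BoundedDegree (G : SimpleGraph V) : Prop :=
  ∃ d : ℕ, ∀ x : V, (G.neighborSet x).encard ≤ (d : ℕ∞)

theorem BoundedDegree.finite {G : SimpleGraph V} (h : G.BoundedDegree) (x : V) :
    (G.neighborSet x).Finite := by
  obtain ⟨d, hd⟩ := h
  exact Set.finite_of_encard_le_coe (hd x)

/-- The graph Laplacian on functions: `(Δ f) x = ∑_{y ~ x} (f x - f y) = deg x * f x - ∑_{y ~ x} f y`. -/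
noncomputable def laplacianFun (G : SimpleGraph V) (h : G.BoundedDegree) (f : V → ℂ) : V → ℂ :=
  fun x => ∑ y ∈ (h.finite x).toFinset, (f x - f y)

theorem BoundedDegree.sum_laplacianFun_le {G : SimpleGraph V} (h : G.BoundedDegree) {d : ℕ}
    (hd : ∀ x : V, (G.neighborSet x).encard ≤ (d : ℕ∞)) (f : V → ℂ)
    (hf : Summable fun x => ‖f x‖ ^ 2) (s : Finset V) :
    ∑ x ∈ s, ‖G.laplacianFun h f x‖ ^ 2 ≤ (2 * (d : ℝ)) ^ 2 * ∑' x, ‖f x‖ ^ 2 := by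
  classical
  have hcard : ∀ x, (((h.finite x).toFinset.card : ℕ) : ℝ) ≤ d := fun x => by
    have := hd x
    rw [(h.finite x).encard_eq_coe_toFinset_card] at this
    exact_mod_cast this
  have hpt : ∀ x, ‖G.laplacianFun h f x‖ ^ 2 ≤
      2 * (d : ℝ) ^ 2 * ‖f x‖ ^ 2 + 2 * d * ∑ y ∈ (h.finite x).toFinset, ‖f y‖ ^ 2 := fun x => by
    have h1 : ‖G.laplacianFun h f x‖ ≤ ∑ y ∈ (h.finite x).toFinset, ‖f x - f y‖ :=
      norm_sum_le _ _
    have h2 := pow_le_pow_left₀ (norm_nonneg _) h1 2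
    have h3 := sq_sum_le_card_mul_sum_sq (s := (h.finite x).toFinset)
      (f := fun y => ‖f x - f y‖)
    have h4 : ∑ y ∈ (h.finite x).toFinset, ‖f x - f y‖ ^ 2 ≤
        ∑ y ∈ (h.finite x).toFinset, (2 * ‖f x‖ ^ 2 + 2 * ‖f y‖ ^ 2) := by
      refine Finset.sum_le_sum fun y _ => ?_
      have := pow_le_pow_left₀ (norm_nonneg _) (norm_sub_le (f x) (f y)) 2
      nlinarith [sq_nonneg (‖f x‖ - ‖f y‖)]
    rw [Finset.sum_add_distrib, Finset.sum_const, nsmul_eq_mul, ← Finset.mul_sum] at h4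
    have h5 : (0 : ℝ) ≤ ∑ y ∈ (h.finite x).toFinset, ‖f y‖ ^ 2 := by positivity
    have hc0 : (0 : ℝ) ≤ (h.finite x).toFinset.card := by positivity
    calc ‖G.laplacianFun h f x‖ ^ 2
        ≤ ((h.finite x).toFinset.card : ℝ) * ((h.finite x).toFinset.card * (2 * ‖f x‖ ^ 2) +
          2 * ∑ y ∈ (h.finite x).toFinset, ‖f y‖ ^ 2) :=
          (h2.trans h3).trans (mul_le_mul_of_nonneg_left h4 hc0)
      _ ≤ (d : ℝ) * (d * (2 * ‖f x‖ ^ 2) +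
          2 * ∑ y ∈ (h.finite x).toFinset, ‖f y‖ ^ 2) := by
          have hc := hcard x
          exact mul_le_mul hc (by gcongr) (by positivity) (by positivity)
      _ = _ := by ring
  have hx : ∑ x ∈ s, ‖f x‖ ^ 2 ≤ ∑' x, ‖f x‖ ^ 2 := hf.sum_le_tsum s fun _ _ => by positivity
  have hy : ∑ x ∈ s, ∑ y ∈ (h.finite x).toFinset, ‖f y‖ ^ 2 ≤ d * ∑' x, ‖f x‖ ^ 2 := by
    set t : Finset V := s.biUnion fun x => (h.finite x).toFinset with ht
    have e1 : ∑ x ∈ s, ∑ y ∈ (h.finite x).toFinset, ‖f y‖ ^ 2 =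
        ∑ y ∈ t, ∑ x ∈ s.filter (fun x => x ∈ (h.finite y).toFinset), ‖f y‖ ^ 2 := by
      refine Finset.sum_comm' fun x y => ?_
      simp only [ht, Finset.mem_biUnion, Set.Finite.mem_toFinset, Finset.mem_filter,
        mem_neighborSet]
      constructor
      · rintro ⟨hxs, hxy⟩
        exact ⟨⟨hxs, hxy.symm⟩, x, hxs, hxy⟩
      · rintro ⟨⟨hxs, hxy⟩, -⟩
        exact ⟨hxs, hxy.symm⟩
    rw [e1]
    calc _ ≤ ∑ y ∈ t, (d : ℝ) * ‖f y‖ ^ 2 := by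
          refine Finset.sum_le_sum fun y _ => ?_
          rw [Finset.sum_const, nsmul_eq_mul]
          refine mul_le_mul_of_nonneg_right (le_trans ?_ (hcard y)) (by positivity)
          exact_mod_cast Finset.card_le_card fun x hx => (Finset.mem_filter.1 hx).2
      _ = d * ∑ y ∈ t, ‖f y‖ ^ 2 := by rw [Finset.mul_sum]
      _ ≤ _ := by
          gcongr
          exact hf.sum_le_tsum t fun _ _ => by positivity
  calc ∑ x ∈ s, ‖G.laplacianFun h f x‖ ^ 2
      ≤ ∑ x ∈ s, (2 * (d : ℝ) ^ 2 * ‖f x‖ ^ 2 +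
          2 * d * ∑ y ∈ (h.finite x).toFinset, ‖f y‖ ^ 2) := Finset.sum_le_sum fun x _ => hpt x
    _ = 2 * (d : ℝ) ^ 2 * ∑ x ∈ s, ‖f x‖ ^ 2 +
          2 * d * ∑ x ∈ s, ∑ y ∈ (h.finite x).toFinset, ‖f y‖ ^ 2 := by
        rw [Finset.sum_add_distrib, Finset.mul_sum, Finset.mul_sum]
    _ ≤ 2 * (d : ℝ) ^ 2 * (∑' x, ‖f x‖ ^ 2) + 2 * d * (d * ∑' x, ‖f x‖ ^ 2) := by gcongr
    _ = _ := by ring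

theorem summable_norm_sq (f : lp (fun _ : V => ℂ) 2) : Summable fun x => ‖f x‖ ^ 2 := by
  simpa using (lp.memℓp f).summable (by norm_num)

theorem BoundedDegree.memℓp_laplacianFun {G : SimpleGraph V} (h : G.BoundedDegree)
    (f : lp (fun _ : V => ℂ) 2) : Memℓp (G.laplacianFun h f) 2 := by
  obtain ⟨d, hd⟩ := id h
  refine memℓp_gen' (C := (2 * (d : ℝ)) ^ 2 * ∑' x, ‖f x‖ ^ 2) fun s => ?_
  simpa using h.sum_laplacianFun_le hd f (summable_norm_sq f) s

/-- The graph Laplacian as a linear map of the Hilbert space `ℓ²(V)` of complex-valued functions. -/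
noncomputable def laplacianLinearMap (G : SimpleGraph V) (h : G.BoundedDegree) :
    lp (fun _ : V => ℂ) 2 →ₗ[ℂ] lp (fun _ : V => ℂ) 2 where
  toFun f := ⟨G.laplacianFun h f, h.memℓp_laplacianFun f⟩
  map_add' f g := by
    ext x
    simp only [laplacianFun, lp.coeFn_add, Pi.add_apply]
    rw [← Finset.sum_add_distrib]
    exact Finset.sum_congr rfl fun y _ => by ring
  map_smul' c f := by
    ext x
    simp only [laplacianFun, lp.coeFn_smul, Pi.smul_apply, smul_eq_mul, RingHom.id_apply]
    rw [Finset.mul_sum]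
    exact Finset.sum_congr rfl fun y _ => by ring

theorem exists_norm_laplacianLinearMap_le (G : SimpleGraph V) (h : G.BoundedDegree) :
    ∃ C : ℝ, ∀ f, ‖G.laplacianLinearMap h f‖ ≤ C * ‖f‖ := by
  obtain ⟨d, hd⟩ := id h
  refine ⟨2 * d, fun f => ?_⟩
  refine lp.norm_le_of_forall_sum_le (by norm_num) (by positivity) fun s => ?_
  have h1 := h.sum_laplacianFun_le hd f (summable_norm_sq f) s
  have h2 := lp.norm_rpow_eq_tsum (p := 2) (by norm_num) f
  simp only [ENNReal.toReal_ofNat, Real.rpow_ofNat] at h2 ⊢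
  rw [mul_pow, h2]
  exact h1

/-- The graph Laplacian of a graph of bounded vertex degrees as a bounded operator on `ℓ²(V)`. -/
noncomputable def laplacian (G : SimpleGraph V) (h : G.BoundedDegree) :
    lp (fun _ : V => ℂ) 2 →L[ℂ] lp (fun _ : V => ℂ) 2 :=
  (G.laplacianLinearMap h).mkContinuousOfExistsBound (G.exists_norm_laplacianLinearMap_le h)

theorem laplacian_apply (G : SimpleGraph V) (h : G.BoundedDegree)
    (f : lp (fun _ : V => ℂ) 2) (x : V) :
    G.laplacian h f x = ∑ y ∈ (h.finite x).toFinset, (f x - f y) := rfl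

theorem nontrivial_lp [Nonempty V] : Nontrivial (lp (fun _ : V => ℂ) 2) := by
  classical
  obtain ⟨x⟩ := ‹Nonempty V›
  refine ⟨lp.single 2 x (1 : ℂ), 0, fun h => ?_⟩
  have := congrArg (fun f : lp (fun _ : V => ℂ) 2 => f x) h
  simp at this

/-- The spectrum of a graph of bounded vertex degrees, that is, the spectrum of its Laplacian on
`ℓ²(V)`, as a non-empty compact set. (`NonemptyCompacts ℂ` carries the Hausdorff metric. The
operator is self-adjoint, so all its spectral values are in fact real.) -/
noncomputable def spec [Nonempty V] (G : SimpleGraph V) (h : G.BoundedDegree) :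
    NonemptyCompacts ℂ where
  carrier := spectrum ℂ (G.laplacian h)
  isCompact' := spectrum.isCompact _
  nonempty' := by
    have := nontrivial_lp (V := V)
    exact spectrum.nonempty _

/-- The Cayley graph of a group with respect to a finite set has bounded vertex degrees. -/
theorem boundedDegree_mulCayley {M : Type*} [Group M] {S : Set M} (hS : S.Finite) :
    (mulCayley S).BoundedDegree := by
  have hfin : (S ∪ S⁻¹).Finite := hS.union hS.inv
  refine ⟨(S ∪ S⁻¹).ncard, fun x => ?_⟩
  rw [hfin.cast_ncard_eq]
  refine le_trans (Set.encard_le_encard (t := (fun g => x * g) '' (S ∪ S⁻¹)) ?_)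
    (Set.encard_image_le _ _)
  intro y hy
  rw [mem_neighborSet, mulCayley_adj] at hy
  refine ⟨x⁻¹ * y, ?_, by simp⟩
  rcases hy.2 with h | h
  · exact Or.inl h
  · exact Or.inr (by simpa using h)

end SimpleGraph

/-! The Laplacians are self-adjoint, so a spectral value is the same as an approximate eigenvalue,
and a residual below `ε * ‖f‖` at `z` forces spectrum within `ε` of `z`. Each half of Hausdorff
convergence transports approximate eigenvectors between the group and a quotient.

From the group to the quotients: an approximate eigenvector may be taken finitely supported. Once
the quotient map is injective near its support, `exists_pushforward_laplacian` copies it to the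
quotient with the same norm and the same residual.

From the quotients to the group: a finite quotient has genuine eigenfunctions. Lifted to the group
and cut off to a Følner set, such a function has a residual only at the boundary. Averaged over
translates, the boundary carries a small share of the mass, so
`IsAmenableGroup.mem_spectrum_of_eigenvector` gives an actual inclusion of spectra for large `k`.

Compactness of the limit spectrum makes the first half uniform in `z`. -/

/-! ### Approximate eigenvectors of normal operators -/

section SpectralTheory

variable {E : Type*} [NormedAddCommGroup E] [InnerProductSpace ℂ E] [CompleteSpace E]

/-- Every spectral value of a normal operator is an approximate eigenvalue. -/
theorem IsStarNormal.exists_norm_sub_smul_lt {A : E →L[ℂ] E} (hA : IsStarNormal A) {z : ℂ}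
    (hz : z ∈ spectrum ℂ A) {ε : ℝ} (hε : 0 < ε) : ∃ f : E, ‖A f - z • f‖ < ε * ‖f‖ := by
  by_contra! hbd
  refine hz (spectrum.mem_resolventSet_iff.2 ?_)
  set B : E →L[ℂ] E := algebraMap ℂ (E →L[ℂ] E) z - A with hB
  have hBapp : ∀ f, B f = z • f - A f := fun f => by simp [hB, Algebra.algebraMap_eq_smul_one]
  have hBn : IsStarNormal B := by
    refine ⟨?_⟩
    have h1 : Commute (star A) A := hA.star_comm_self
    have h2 : ∀ (w : ℂ) (C : E →L[ℂ] E), Commute (algebraMap ℂ (E →L[ℂ] E) w) C :=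
      fun w C => Algebra.commutes w C
    have hs : star B = algebraMap ℂ (E →L[ℂ] E) (star z) - star A := by
      rw [hB, star_sub, ← algebraMap_star_comm]
    rw [hs]
    exact ((h2 _ _).sub_right (h2 _ _)).sub_left ((h2 _ _).symm.sub_right h1)
  have hanti : AntilipschitzWith ⟨ε⁻¹, by positivity⟩ B := by
    refine B.antilipschitz_of_bound fun f => ?_
    have := hbd f
    rw [hBapp, norm_sub_rev]
    change ‖f‖ ≤ ε⁻¹ * _
    rwa [inv_mul_eq_div, le_div_iff₀ hε, mul_comm]
  rw [ContinuousLinearMap.isUnit_iff_bijective,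
    ContinuousLinearMap.bijective_iff_dense_range_and_antilipschitz]
  refine ⟨?_, _, hanti⟩
  -- For normal `B` the orthogonal complement of the range is the kernel, which the lower bound
  -- makes trivial; hence the range is dense.
  rw [Submodule.topologicalClosure_eq_top_iff, ContinuousLinearMap.IsStarNormal.orthogonal_range hBn]
  exact LinearMap.ker_eq_bot.2 hanti.injective

/-- A normal operator whose spectrum stays at distance `ε` from `z` is bounded below by `ε`
after subtraction of `z`. -/
theorem IsStarNormal.mul_norm_le_norm_sub_smul {A : E →L[ℂ] E} (hA : IsStarNormal A) {z : ℂ}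
    {ε : ℝ} (hε : 0 < ε) (hz : ∀ w ∈ spectrum ℂ A, ε ≤ dist z w) (f : E) :
    ε * ‖f‖ ≤ ‖A f - z • f‖ := by
  have hne : ∀ w ∈ spectrum ℂ A, w - z ≠ 0 := fun w hw h => by
    have := hz w hw
    rw [sub_eq_zero.1 h, dist_self] at this
    linarith
  have hc : ContinuousOn (fun w : ℂ => (w - z)⁻¹) (spectrum ℂ A) :=
    ContinuousOn.inv₀ (by fun_prop) hne
  have hmul : cfc (fun w : ℂ => (w - z)⁻¹) A * (A - algebraMap ℂ (E →L[ℂ] E) z) = 1 := by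
    have h1 : A - algebraMap ℂ (E →L[ℂ] E) z = cfc (fun w : ℂ => w - z) A := by
      rw [cfc_sub (fun w : ℂ => w) (fun _ => z) A, cfc_id' ℂ A, cfc_const z A]
    rw [h1, ← cfc_mul _ _ A hc (by fun_prop), ← cfc_const_one ℂ A]
    exact cfc_congr fun w hw => inv_mul_cancel₀ (hne w hw)
  have hnorm : ‖cfc (fun w : ℂ => (w - z)⁻¹) A‖ ≤ ε⁻¹ := by
    refine norm_cfc_le (by positivity) fun w hw => ?_
    rw [norm_inv, ← dist_eq_norm, dist_comm]
    exact inv_anti₀ hε (hz w hw)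
  have h2 : f = cfc (fun w : ℂ => (w - z)⁻¹) A (A f - z • f) := by
    have := congrArg (fun C : E →L[ℂ] E => C f) hmul
    simpa [Algebra.algebraMap_eq_smul_one] using this.symm
  have h3 : ‖f‖ ≤ ε⁻¹ * ‖A f - z • f‖ := by
    conv_lhs => rw [h2]
    exact (ContinuousLinearMap.le_opNorm _ _).trans (by gcongr)
  rwa [inv_mul_eq_div, le_div_iff₀ hε, mul_comm] at h3

theorem IsStarNormal.exists_pos_mul_norm_le_norm_sub_smul {A : E →L[ℂ] E} (hA : IsStarNormal A)
    {z : ℂ} (hz : z ∉ spectrum ℂ A) : ∃ c > 0, ∀ f : E, c * ‖f‖ ≤ ‖A f - z • f‖ := by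
  obtain ⟨c, hc, h⟩ := Metric.isOpen_iff.1 (spectrum.isClosed A).isOpen_compl z hz
  refine ⟨c, hc, fun f => hA.mul_norm_le_norm_sub_smul hc (fun w hw => ?_) f⟩
  by_contra! hlt
  exact h (Metric.mem_ball'.2 hlt) hw

/-- In finite dimension every spectral value is an eigenvalue. -/
theorem exists_eigenvector_of_mem_spectrum [FiniteDimensional ℂ E] {A : E →L[ℂ] E} {z : ℂ}
    (hz : z ∈ spectrum ℂ A) : ∃ f : E, f ≠ 0 ∧ A f = z • f := by
  by_contra! h
  refine hz (spectrum.mem_resolventSet_iff.2 ?_)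
  set B : E →L[ℂ] E := algebraMap ℂ (E →L[ℂ] E) z - A with hB
  have hinj : Function.Injective B := by
    refine (injective_iff_map_eq_zero B).2 fun f hf => ?_
    by_contra h0
    refine h f h0 ?_
    have h1 : z • f - A f = 0 := by simpa [hB, Algebra.algebraMap_eq_smul_one] using hf
    exact (sub_eq_zero.1 h1).symm
  rw [ContinuousLinearMap.isUnit_iff_bijective]
  exact ⟨hinj, LinearMap.injective_iff_surjective.1 (show Function.Injective B.toLinearMap from hinj)⟩

end SpectralTheory

/-! ### Finitely supported functions in `ℓ²` -/

section SquareSummable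

variable {V : Type*}

theorem lp.norm_sq_eq_sum_of_support (f : lp (fun _ : V => ℂ) 2) (s : Finset V)
    (hs : ∀ x ∉ s, f x = 0) : ‖f‖ ^ 2 = ∑ x ∈ s, ‖f x‖ ^ 2 := by
  have h := lp.norm_rpow_eq_tsum (p := 2) (by norm_num) f
  simp only [ENNReal.toReal_ofNat, Real.rpow_ofNat] at h
  rw [h]
  exact tsum_eq_sum fun x hx => by simp [hs x hx]

/-- Every `f` is the sum of its point masses, so an open condition that holds at `f` already holds
at a finite partial sum. -/
theorem lp.exists_support_of_continuous {p : lp (fun _ : V => ℂ) 2 → Prop}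
    (hp : IsOpen {f | p f}) (h : ∃ f, p f) :
    ∃ (f : lp (fun _ : V => ℂ) 2) (s : Finset V), (∀ x ∉ s, f x = 0) ∧ p f := by
  classical
  obtain ⟨f, hf⟩ := h
  obtain ⟨s, hs⟩ := ((lp.hasSum_single (by norm_num) f).eventually (hp.mem_nhds hf)).exists
  refine ⟨_, s, fun x hx => ?_, hs⟩
  rw [lp.coeFn_sum, Finset.sum_apply]
  refine Finset.sum_eq_zero fun y hy => ?_
  rw [lp.single_apply_ne]
  rintro rfl
  exact hx hy

instance lp.finiteDimensional_of_finite [Finite V] :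
    FiniteDimensional ℂ (lp (fun _ : V => ℂ) 2) := by
  let L : lp (fun _ : V => ℂ) 2 →ₗ[ℂ] (V → ℂ) :=
    { toFun := fun f => f
      map_add' := fun _ _ => rfl
      map_smul' := fun _ _ => rfl }
  exact FiniteDimensional.of_injective L fun f g h => lp.ext h

end SquareSummable

/-! ### Self-adjointness and the Laplacian of a Cayley graph -/

namespace SimpleGraph

variable {V : Type*}

theorem laplacian_single [DecidableEq V] (G : SimpleGraph V) (h : G.BoundedDegree) (x : V) :
    G.laplacian h (lp.single 2 x 1) =
      ∑ y ∈ (h.finite x).toFinset, (lp.single 2 x (1 : ℂ) - lp.single 2 y 1) := by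
  ext z
  rw [laplacian_apply, lp.coeFn_sum, Finset.sum_apply]
  simp only [lp.coeFn_sub, Pi.sub_apply, lp.single_apply, Pi.single_apply]
  by_cases hz : z = x
  · subst hz
    refine Finset.sum_congr rfl fun y hy => ?_
    have : G.Adj z y := by simpa using hy
    simp [this.ne, this.ne']
  · simp [hz, Finset.sum_ite_eq]
    refine if_congr ?_ rfl rfl
    rw [Set.Finite.mem_toFinset, Set.Finite.mem_toFinset]
    exact G.adj_comm z x

theorem isSelfAdjoint_laplacian (G : SimpleGraph V) (h : G.BoundedDegree) :
    IsSelfAdjoint (G.laplacian h) := by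
  classical
  rw [ContinuousLinearMap.isSelfAdjoint_iff']
  ext f x
  have key : ∀ g : lp (fun _ : V => ℂ) 2, g x = inner ℂ (lp.single 2 x (1 : ℂ)) g := fun g => by
    rw [lp.inner_single_left]
    simp
  rw [key, ContinuousLinearMap.adjoint_inner_right, laplacian_single, sum_inner, laplacian_apply]
  refine Finset.sum_congr rfl fun y _ => ?_
  rw [inner_sub_left, lp.inner_single_left, lp.inner_single_left]
  simp

/-- If `φ` is injective on `S ∪ {1}`, then the Laplacian of the Cayley graph of the target with
respect to the image of `S` sums over the elements of `S` other than `1`. -/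
theorem laplacian_mulCayley_apply {Γ H : Type*} [Group Γ] [Group H] (φ : Γ →* H) {S : Set Γ}
    (hsymm : ∀ s ∈ S, s⁻¹ ∈ S) {T : Finset Γ} (hT : ∀ s, s ∈ T ↔ s ∈ S ∧ s ≠ 1)
    (hinj : Set.InjOn φ (insert 1 S)) {S' : Set H} (hS' : S' = φ '' S)
    (h : (mulCayley S').BoundedDegree) (f : lp (fun _ : H => ℂ) 2) (q : H) :
    (mulCayley S').laplacian h f q = ∑ s ∈ T, (f q - f (q * φ s)) := by
  classical
  subst hS'
  -- Injectivity on `insert 1 S` keeps the neighbours `q * φ s` distinct from one another and from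
  -- `q`; symmetry of `S` absorbs edges written in the other direction.
  have himg : (h.finite q).toFinset = T.image fun s => q * φ s := by
    ext y
    simp only [Set.Finite.mem_toFinset, mem_neighborSet, mulCayley_adj', Finset.mem_image, hT]
    constructor
    · rintro ⟨hne, -, ⟨s, hs, rfl⟩, rfl | rfl⟩
      · exact ⟨s, ⟨hs, fun h1 => by simp [h1] at hne⟩, rfl⟩
      · exact ⟨s⁻¹, ⟨hsymm s hs, fun h1 => by simp [inv_eq_one.1 h1] at hne⟩, by simp⟩
    · rintro ⟨s, ⟨hs, hs1⟩, rfl⟩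
      refine ⟨fun h1 => hs1 ?_, φ s, ⟨s, hs, rfl⟩, Or.inl rfl⟩
      refine hinj (Set.mem_insert_of_mem _ hs) (Set.mem_insert _ _) ?_
      simpa using h1
  rw [laplacian_apply, himg, Finset.sum_image]
  intro s hs t ht hst
  exact hinj (Set.mem_insert_of_mem _ ((hT s).1 hs).1) (Set.mem_insert_of_mem _ ((hT t).1 ht).1)
    (mul_left_cancel hst)

end SimpleGraph

/-! ### Transport of approximate eigenvectors along a homomorphism -/

section Quasimodes

variable {Γ H : Type*} [Group Γ] [Group H] (φ : Γ →* H) {T : Finset Γ}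
  {A : lp (fun _ : Γ => ℂ) 2 →L[ℂ] lp (fun _ : Γ => ℂ) 2}
  {B : lp (fun _ : H => ℂ) 2 →L[ℂ] lp (fun _ : H => ℂ) 2}

/-- A finitely supported function is pushed forward isometrically, and compatibly with the
Laplacian, along a homomorphism which is injective on a large enough finite set. -/
theorem exists_pushforward_laplacian [DecidableEq Γ]
    (hA : ∀ f x, A f x = ∑ s ∈ T, (f x - f (x * s)))
    (hB : ∀ f x, B f x = ∑ s ∈ T, (f x - f (x * φ s)))
    (f : lp (fun _ : Γ => ℂ) 2) {P Q : Finset Γ} (hf : ∀ x ∉ P, f x = 0)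
    (hPQ : P ⊆ Q) (hQ : ∀ x ∈ P, ∀ s ∈ T, x * s⁻¹ ∈ Q)
    (hinj : Set.InjOn φ (Q ∪ Q * T : Finset Γ)) (z : ℂ) :
    ∃ g : lp (fun _ : H => ℂ) 2, ‖g‖ = ‖f‖ ∧ ‖B g - z • g‖ = ‖A f - z • f‖ := by
  classical
  set g : lp (fun _ : H => ℂ) 2 := ∑ p ∈ P, lp.single 2 (φ p) (f p) with hg
  have hgq : ∀ q, g q = ∑ p ∈ P, if q = φ p then f p else 0 := fun q => by
    rw [hg, lp.coeFn_sum, Finset.sum_apply]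
    simp [lp.single_apply, Pi.single_apply]
  have hg0 : ∀ q, (∀ p ∈ P, q ≠ φ p) → g q = 0 := fun q hq => by
    rw [hgq]
    exact Finset.sum_eq_zero fun p hp => if_neg (hq p hp)
  -- The Laplacian at a point of `Q` also reads values on `Q * T`, so `g` must agree with `f` there
  -- too.
  have hgx : ∀ x ∈ Q ∪ Q * T, g (φ x) = f x := fun x hx => by
    have h1 : ∀ p ∈ P, (φ x = φ p ↔ x = p) := fun p hp =>
      ⟨fun h => hinj hx (Finset.mem_union_left _ (hPQ hp)) h, fun h => by rw [h]⟩
    rw [hgq, Finset.sum_congr rfl fun p hp => by rw [if_congr (h1 p hp) rfl rfl],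
      Finset.sum_ite_eq]
    split_ifs with h
    · rfl
    · exact (hf x h).symm
  have hinjQ : Set.InjOn φ Q := hinj.mono fun x hx => Finset.mem_union_left _ hx
  have norm_eq : ∀ (u : lp (fun _ : Γ => ℂ) 2) (v : lp (fun _ : H => ℂ) 2),
      (∀ x ∉ Q, u x = 0) → (∀ q ∉ Q.image φ, v q = 0) → (∀ x ∈ Q, v (φ x) = u x) →
      ‖v‖ = ‖u‖ := fun u v hu hv huv => by
    rw [← sq_eq_sq₀ (norm_nonneg _) (norm_nonneg _), lp.norm_sq_eq_sum_of_support u Q hu,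
      lp.norm_sq_eq_sum_of_support v _ hv, Finset.sum_image hinjQ]
    exact Finset.sum_congr rfl fun x hx => by rw [huv x hx]
  have hfQ : ∀ x ∉ Q, f x = 0 := fun x hx => hf x fun h => hx (hPQ h)
  have hgQ : ∀ q ∉ Q.image φ, g q = 0 := fun q hq =>
    hg0 q fun p hp h => hq (Finset.mem_image.2 ⟨p, hPQ hp, h.symm⟩)
  refine ⟨g, norm_eq f g hfQ hgQ fun x hx => hgx x (Finset.mem_union_left _ hx),
    norm_eq _ _ (fun x hx => ?_) (fun q hq => ?_) fun x hx => ?_⟩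
  · have h1 : ∀ s ∈ T, f x - f (x * s) = 0 := fun s hs => by
      rw [hfQ x hx, hf (x * s) fun h => hx (by simpa using hQ _ h s hs), sub_zero]
    rw [lp.coeFn_sub, Pi.sub_apply, hA, Finset.sum_eq_zero h1]
    simp [hfQ x hx]
  · have h1 : ∀ s ∈ T, g q - g (q * φ s) = 0 := fun s hs => by
      rw [hgQ q hq, hg0 (q * φ s), sub_zero]
      intro p hp h
      refine hq (Finset.mem_image.2 ⟨_, hQ p hp s hs, ?_⟩)
      simp [← h]
    rw [lp.coeFn_sub, Pi.sub_apply, hB, Finset.sum_eq_zero h1]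
    simp [hgQ q hq]
  · have hx' := hgx x (Finset.mem_union_left _ hx)
    simp only [lp.coeFn_sub, lp.coeFn_smul, Pi.sub_apply, Pi.smul_apply, hA, hB, hx']
    congr 1
    refine Finset.sum_congr rfl fun s hs => ?_
    rw [← map_mul, hgx (x * s) (Finset.mem_union_right _ (Finset.mul_mem_mul hx hs))]

/-- For an amenable group, an eigenvalue of the Laplacian of a finite quotient is a spectral value
of the Laplacian of the group. -/
theorem IsAmenableGroup.mem_spectrum_of_eigenvector [Finite H] (hΓ : IsAmenableGroup Γ)
    (hAn : IsStarNormal A)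
    (hA : ∀ f x, A f x = ∑ s ∈ T, (f x - f (x * s)))
    (hB : ∀ f x, B f x = ∑ s ∈ T, (f x - f (x * φ s)))
    {z : ℂ} {g : lp (fun _ : H => ℂ) 2} (hg : g ≠ 0) (hBg : B g = z • g) :
    z ∈ spectrum ℂ A := by
  classical
  have := Fintype.ofFinite H
  by_contra hz
  obtain ⟨c, hc, hcA⟩ := hAn.exists_pos_mul_norm_le_norm_sub_smul hz
  set n : ℝ := (T.card : ℝ) with hn
  -- The final estimate costs a factor `n ^ 2`; the `+ 1` makes `n ^ 2 / (n ^ 2 + 1) < 1`, also when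
  -- `T` is empty.
  obtain ⟨F, hF, hFT⟩ := hΓ T (c ^ 2 / (n ^ 2 + 1)) (by positivity)
  -- Følner sets are almost invariant on the left, while Cayley edges multiply on the right;
  -- inversion exchanges the two.
  set E : Finset Γ := F⁻¹ with hE
  have hEF : E.card = F.card := Finset.card_inv F
  -- the boundary of `E` in the direction `s`
  set D : Γ → Finset Γ := fun s => (E * {s}) ∆ E with hD
  have hDcard : ∀ s ∈ T, ((D s).card : ℝ) ≤ c ^ 2 / (n ^ 2 + 1) * E.card := fun s hs => by
    refine le_trans (le_of_eq ?_) ((hFT s hs).trans_eq (by rw [hEF]))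
    have h1 : ((s • (F : Set Γ)) ∆ (F : Set Γ)) = (((s • F) ∆ F : Finset Γ) : Set Γ) := by
      push_cast
      rfl
    have h2 : D s = ((s • F) ∆ F).image fun w => w⁻¹ * s := by
      have h3 : ∀ y w : Γ, w⁻¹ * s = y ↔ w = s * y⁻¹ := fun y w => by
        rw [← inv_inj, mul_inv_rev, inv_inv, inv_mul_eq_iff_eq_mul]
      have h4 : ∀ y, y ∈ F⁻¹ * {s} ↔ s * y⁻¹ ∈ F := fun y => by
        simp only [Finset.mem_mul, Finset.mem_singleton, exists_eq_left, Finset.mem_inv']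
        constructor
        · rintro ⟨a, ha, rfl⟩
          simpa using ha
        · exact fun h => ⟨y * s⁻¹, by simpa using h, by simp⟩
      ext y
      simp [hD, h4, or_comm, hE, Finset.mem_symmDiff, h3, ← Finset.inv_smul_mem_iff]
    rw [h1, Set.ncard_coe_finset, h2, Finset.card_image_of_injective]
    exact (mul_left_injective s).comp inv_injective
  -- the total mass of the translates of the lift of `g` over a finite set
  have mass : ∀ X : Finset Γ, ∑ t : H, ∑ x ∈ X, ‖g (t * φ x)‖ ^ 2 = X.card * ‖g‖ ^ 2 := fun X => by
    rw [Finset.sum_comm, lp.norm_sq_eq_sum_of_support g Finset.univ (by simp), ← nsmul_eq_mul,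
      ← Finset.sum_const]
    refine Finset.sum_congr rfl fun x _ => ?_
    exact Fintype.sum_equiv (Equiv.mulRight (φ x)) _ _ fun t => rfl
  -- Left translation by `t` preserves the eigenvalue equation. For a single `t` the mass could sit
  -- near the boundary of `E`; summing over all `t` equidistributes it.
  set f : H → lp (fun _ : Γ => ℂ) 2 := fun t => ∑ x ∈ E, lp.single 2 x (g (t * φ x)) with hf
  have hfx : ∀ t x, f t x = if x ∈ E then g (t * φ x) else 0 := fun t x => by
    rw [hf]
    simp only [lp.coeFn_sum, Finset.sum_apply, lp.single_apply, Pi.single_apply]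
    exact Finset.sum_ite_eq E x _
  have hfnorm : ∀ t, ‖f t‖ ^ 2 = ∑ x ∈ E, ‖g (t * φ x)‖ ^ 2 := fun t => by
    rw [lp.norm_sq_eq_sum_of_support (f t) E fun x hx => by rw [hfx, if_neg hx]]
    exact Finset.sum_congr rfl fun x hx => by rw [hfx, if_pos hx]
  have heig : ∀ q, ∑ s ∈ T, (g q - g (q * φ s)) = z * g q := fun q => by
    rw [← hB, hBg]
    rfl
  -- By the eigenvalue equation the bulk terms cancel, leaving only edges with exactly one end in
  -- `E`.
  have hAf : ∀ t x, (A (f t) - z • f t) x = ∑ s ∈ T,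
      ((if x ∈ E then 1 else 0) - if x * s ∈ E then 1 else 0) * g (t * φ (x * s)) :=
    fun t x => by
      have h1 : (z • f t) x = ∑ s ∈ T, (if x ∈ E then 1 else 0) *
          (g (t * φ x) - g (t * φ (x * s))) := by
        rw [← Finset.mul_sum]
        simp only [map_mul, ← mul_assoc]
        rw [heig]
        simp [hfx]
      rw [lp.coeFn_sub, Pi.sub_apply, h1, hA, ← Finset.sum_sub_distrib]
      refine Finset.sum_congr rfl fun s _ => ?_
      rw [hfx, hfx]
      split_ifs <;> ring
  have hAfnorm : ∀ t, ‖A (f t) - z • f t‖ ^ 2 ≤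
      n * ∑ s ∈ T, ∑ y ∈ D s, ‖g (t * φ y)‖ ^ 2 := fun t => by
    set X : Finset Γ := E ∪ E * T⁻¹ with hX
    rw [lp.norm_sq_eq_sum_of_support _ X]
    · have hpt : ∀ x, ‖(A (f t) - z • f t) x‖ ^ 2 ≤
          n * ∑ s ∈ T, if x * s ∈ D s then ‖g (t * φ (x * s))‖ ^ 2 else 0 := fun x => by
        rw [hAf]
        refine (pow_le_pow_left₀ (norm_nonneg _) (norm_sum_le _ _) 2).trans ?_
        refine sq_sum_le_card_mul_sum_sq.trans ?_
        refine mul_le_mul_of_nonneg_left (Finset.sum_le_sum fun s _ => ?_) (Nat.cast_nonneg _)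
        have hmem : x * s ∈ D s ↔ (x ∈ E ∧ x * s ∉ E) ∨ (x * s ∈ E ∧ x ∉ E) := by
          simp [hD, Finset.mem_symmDiff, Finset.mem_mul]
        by_cases h1 : x ∈ E <;> by_cases h2 : x * s ∈ E <;> simp [hmem, h1, h2]
      refine (Finset.sum_le_sum fun x _ => hpt x).trans ?_
      rw [← Finset.mul_sum, Finset.sum_comm]
      refine mul_le_mul_of_nonneg_left (Finset.sum_le_sum fun s _ => ?_) (Nat.cast_nonneg _)
      rw [← Finset.sum_filter]
      have hi : Set.InjOn (fun x => x * s) (X.filter fun x => x * s ∈ D s : Finset Γ) :=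
        (mul_left_injective s).injOn
      rw [← Finset.sum_image (f := fun y => ‖g (t * φ y)‖ ^ 2) hi]
      refine Finset.sum_le_sum_of_subset_of_nonneg (fun y hy => ?_) fun _ _ _ => by positivity
      obtain ⟨x, hx, rfl⟩ := Finset.mem_image.1 hy
      exact (Finset.mem_filter.1 hx).2
    · intro x hx
      rw [hAf]
      refine Finset.sum_eq_zero fun s hs => ?_
      have h1 : x ∉ E := fun h => hx (Finset.mem_union_left _ h)
      have h2 : x * s ∉ E := fun h => hx (Finset.mem_union_right _
        (Finset.mem_mul.2 ⟨x * s, h, s⁻¹, Finset.inv_mem_inv hs, by simp⟩))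
      simp [h1, h2]
  have hgpos : 0 < ‖g‖ ^ 2 := by positivity
  have hEpos : (0 : ℝ) < E.card := by
    rw [hEF]
    exact_mod_cast hF.card_pos
  have lower : c ^ 2 * (E.card * ‖g‖ ^ 2) ≤ ∑ t : H, ‖A (f t) - z • f t‖ ^ 2 := by
    rw [← mass E, Finset.mul_sum]
    refine Finset.sum_le_sum fun t _ => ?_
    rw [← hfnorm, ← mul_pow]
    exact pow_le_pow_left₀ (by positivity) (hcA _) 2
  have upper : ∑ t : H, ‖A (f t) - z • f t‖ ^ 2 ≤
      n * (n * (c ^ 2 / (n ^ 2 + 1) * E.card * ‖g‖ ^ 2)) := by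
    refine (Finset.sum_le_sum fun t _ => hAfnorm t).trans ?_
    rw [← Finset.mul_sum, Finset.sum_comm]
    refine mul_le_mul_of_nonneg_left ?_ (Nat.cast_nonneg _)
    rw [hn, ← nsmul_eq_mul]
    refine Finset.sum_le_card_nsmul _ _ _ fun s hs => ?_
    rw [mass]
    exact mul_le_mul_of_nonneg_right (hDcard s hs) hgpos.le
  have h3 : n * (n * (c ^ 2 / (n ^ 2 + 1) * E.card * ‖g‖ ^ 2)) =
      n ^ 2 / (n ^ 2 + 1) * (c ^ 2 * (E.card * ‖g‖ ^ 2)) := by ring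
  have h4 : n ^ 2 / (n ^ 2 + 1) < 1 := (div_lt_one (by positivity)).2 (by linarith)
  have h5 : 0 < c ^ 2 * (E.card * ‖g‖ ^ 2) := by positivity
  have h6 := mul_lt_mul_of_pos_right h4 h5
  linarith

end Quasimodes

/-! ### Convergence of the spectra -/

/-- A decreasing sequence of normal subgroups with trivial intersection is eventually injective
on every finite set. -/
theorem eventually_injOn_mk {Γ : Type*} [Group Γ] {N : ℕ → Subgroup Γ} [∀ k, (N k).Normal]
    (hnested : Antitone N) (htriv : ⨅ k, N k = ⊥) {K : Set Γ} (hK : K.Finite) :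
    ∀ᶠ k in atTop, Set.InjOn (QuotientGroup.mk' (N k)) K := by
  have h : ∀ᶠ k in atTop, ∀ a ∈ K, ∀ b ∈ K,
      QuotientGroup.mk' (N k) a = QuotientGroup.mk' (N k) b → a = b := by
    refine (eventually_all_finite hK).2 fun a _ => (eventually_all_finite hK).2 fun b _ => ?_
    by_cases hab : a = b
    · exact Eventually.of_forall fun _ _ => hab
    · have h1 : a⁻¹ * b ∉ ⨅ k, N k := by
        rw [htriv, Subgroup.mem_bot, inv_mul_eq_one]
        exact hab
      rw [Subgroup.mem_iInf, not_forall] at h1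
      obtain ⟨k₀, hk₀⟩ := h1
      filter_upwards [eventually_ge_atTop k₀] with k hk heq
      exact absurd (hnested hk (QuotientGroup.eq.1 heq)) hk₀
  filter_upwards [h] with k hk a ha b hb hab using hk a ha b hb hab

theorem mainTheorem4 {Γ : Type*} [Group Γ] (hΓ : IsAmenableGroup Γ)
    (S : Set Γ) (hfin : S.Finite) (hsymm : ∀ s ∈ S, s⁻¹ ∈ S) (hgen : Subgroup.closure S = ⊤)
    (N : ℕ → Subgroup Γ) [∀ k, (N k).Normal] [∀ k, (N k).FiniteIndex]
    (hnested : Antitone N) (htriv : ⨅ k, N k = ⊥) :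
    Tendsto
      (fun k : ℕ => (SimpleGraph.mulCayley (((↑) : Γ → Γ ⧸ N k) '' S)).spec
        (SimpleGraph.boundedDegree_mulCayley (hfin.image ((↑) : Γ → Γ ⧸ N k))))
      atTop
      (𝓝 ((SimpleGraph.mulCayley S).spec (SimpleGraph.boundedDegree_mulCayley hfin))) := by
  classical
  set A := (SimpleGraph.mulCayley S).laplacian (SimpleGraph.boundedDegree_mulCayley hfin) with hAdef
  set B := fun k => (SimpleGraph.mulCayley (((↑) : Γ → Γ ⧸ N k) '' S)).laplacian
    (SimpleGraph.boundedDegree_mulCayley (hfin.image ((↑) : Γ → Γ ⧸ N k))) with hBdef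
  have hAn : IsStarNormal A := (SimpleGraph.isSelfAdjoint_laplacian _ _).isStarNormal
  have hBn : ∀ k, IsStarNormal (B k) := fun k =>
    (SimpleGraph.isSelfAdjoint_laplacian _ _).isStarNormal
  set T : Finset Γ := hfin.toFinset.erase 1 with hTdef
  have hT : ∀ s, s ∈ T ↔ s ∈ S ∧ s ≠ 1 := fun s => by simp [hTdef, and_comm]
  have hA : ∀ f x, A f x = ∑ s ∈ T, (f x - f (x * s)) := fun f x =>
    SimpleGraph.laplacian_mulCayley_apply (MonoidHom.id Γ) hsymm hT Function.injective_id.injOn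
      (by simp) _ f x
  have hB : ∀ᶠ k in atTop, ∀ f x, B k f x =
      ∑ s ∈ T, (f x - f (x * QuotientGroup.mk' (N k) s)) := by
    filter_upwards [eventually_injOn_mk hnested htriv (hfin.insert 1)] with k hk f x
    exact SimpleGraph.laplacian_mulCayley_apply (QuotientGroup.mk' (N k)) hsymm hT hk rfl _ f x
  have hupper : ∀ᶠ k in atTop, spectrum ℂ (B k) ⊆ spectrum ℂ A := by
    filter_upwards [hB] with k hk z hz
    obtain ⟨g, hg, hBg⟩ := exists_eigenvector_of_mem_spectrum hz
    exact hΓ.mem_spectrum_of_eigenvector (QuotientGroup.mk' (N k)) hAn hA hk hg hBg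
  have hlower : ∀ ε > 0, ∀ z ∈ spectrum ℂ A,
      ∀ᶠ k in atTop, ∃ w ∈ spectrum ℂ (B k), dist z w < ε := fun ε hε z hz => by
    -- The strict inequality is an open condition, so it survives truncation; it also excludes `f =
    -- 0`.
    obtain ⟨f, P, hfP, hf⟩ := lp.exists_support_of_continuous
      (isOpen_lt (by fun_prop) (by fun_prop)) (hAn.exists_norm_sub_smul_lt hz hε)
    set Q : Finset Γ := P ∪ P * T⁻¹ with hQ
    filter_upwards [hB, eventually_injOn_mk hnested htriv (Q ∪ Q * T).finite_toSet] with k hk hinj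
    obtain ⟨g, hgf, hg⟩ := exists_pushforward_laplacian (QuotientGroup.mk' (N k)) hA hk f hfP
      Finset.subset_union_left
      (fun x hx s hs => Finset.mem_union_right _
        (Finset.mul_mem_mul hx (Finset.inv_mem_inv hs))) hinj z
    by_contra! hfar
    have := (hBn k).mul_norm_le_norm_sub_smul hε hfar g
    rw [hg, hgf] at this
    linarith
  rw [Metric.tendsto_nhds]
  intro ε hε
  -- A finite net turns the pointwise statement `hlower` into one eventual bound: `ε / 4` to the net
  -- and `ε / 4` from there to the spectrum of `B k`.
  obtain ⟨t, htA, htfin, htcover⟩ := (spectrum.isCompact (𝕜 := ℂ) A).finite_cover_balls (e := ε / 4)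
    (by positivity)
  have hnet : ∀ᶠ k in atTop, ∀ z ∈ t, ∃ w ∈ spectrum ℂ (B k), dist z w < ε / 4 :=
    (eventually_all_finite htfin).2 fun z hz => hlower _ (by positivity) z (htA hz)
  filter_upwards [hupper, hnet] with k hk hkt
  rw [Metric.NonemptyCompacts.dist_eq]
  refine lt_of_le_of_lt (b := ε / 2) (Metric.hausdorffDist_le_of_mem_dist (by positivity)
    (fun z hz => ⟨z, hk hz, by simp; positivity⟩) fun z hz => ?_) (by linarith)
  obtain ⟨y, hy, hzy⟩ := Set.mem_iUnion₂.1 (htcover hz)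
  obtain ⟨w, hw, hyw⟩ := hkt y hy
  refine ⟨w, hw, ?_⟩
  have := dist_triangle z y w
  have := Metric.mem_ball.1 hzy
  linarith
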